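/- Let $n \ge 1$, let $|\cdot|$ be the Euclidean norm on $\mathbf{R}^n$, and let $\phi : \mathbf{R}^n \to \mathbf{R}$ be a norm which is of class $\mathcal{C}^2$ on $\mathbf{R}^n \setminus \{0\}$ and uniformly convex, in the sense that for some $\gamma > 0$ the function $x \mapsto \phi(x) - \gamma |x|$ is convex on $\mathbf{R}^n$. Let $K \subseteq \mathbf{R}^n$ be a closed set and define \[ \delta_K^\phi(x) = \inf\{\phi(y-x) : y \in K\} \quad (x \in \mathbf{R}^n), \] \[ N^\phi(K) = \{(a,\eta) : a \in K,\ \eta \in \mathbf{R}^n,\ \phi(\eta) = 1,\ \delta_K^\phi(a+s\eta) = s \text{ for some } s > 0\}, \] \[ r_K^\phi(a,\eta) = \sup\{s > 0 : \delta_K^\phi(a+s\eta) = s\} \in (0,+\infty] \quad \text{for } (a,\eta) \in N^\phi(K). \] Let $1 < \sigma < \infty$ and $0 < s < t < \infty$, and let \[ K_{\sigma,s,t} = \{a + \rho\eta : (a,\eta) \in N^\phi(K),\ s \le \rho \le t,\ \sigma\rho \le r_K^\phi(a,\eta)\}. \] Then $\delta_K^\phi$ is differentiable at every point of $K_{\sigma,s,t}$,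 and the restriction of its gradient $\nabla\delta_K^\phi$ to $K_{\sigma,s,t}$ is Lipschitz continuous, i.e. there is $L < \infty$ such that $|\nabla\delta_K^\phi(x) - \nabla\delta_K^\phi(y)| \le L\,|x-y|$ for all $x, y \in K_{\sigma,s,t}$. -/

import Mathlib

/-- `φ` is a uniformly convex norm on `ℝⁿ`: it is a norm (a seminorm vanishing only at the origin)
and `x ↦ φ x - γ |x|` is convex for some `γ > 0`, where `|x|` is the Euclidean norm. -/
structure IsUniformlyConvexNorm {n : ℕ} (φ : Seminorm ℝ (EuclideanSpace ℝ (Fin n))) : Prop where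
  eq_zero_of_apply_eq_zero : ∀ x : EuclideanSpace ℝ (Fin n), φ x = 0 → x = 0
  exists_convexOn_sub : ∃ γ : ℝ, 0 < γ ∧
    ConvexOn ℝ Set.univ (fun x : EuclideanSpace ℝ (Fin n) => φ x - γ * ‖x‖)

/-- The `φ`-distance function `x ↦ inf {φ (y - x) : y ∈ K}`. -/
noncomputable def phiDist {n : ℕ} (φ : Seminorm ℝ (EuclideanSpace ℝ (Fin n)))
    (K : Set (EuclideanSpace ℝ (Fin n))) (x : EuclideanSpace ℝ (Fin n)) : ℝ :=
  sInf ((fun y => φ (y - x)) '' K)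

/-- The unit `φ`-normal bundle of `K`: the pairs `(a, η)` with `a ∈ K`, `φ η = 1`, and
`phiDist φ K (a + s η) = s` for some `s > 0`. -/
def unitNormalBundle {n : ℕ} (φ : Seminorm ℝ (EuclideanSpace ℝ (Fin n)))
    (K : Set (EuclideanSpace ℝ (Fin n))) :
    Set (EuclideanSpace ℝ (Fin n) × EuclideanSpace ℝ (Fin n)) :=
  {p | p.1 ∈ K ∧ φ p.2 = 1 ∧ ∃ s : ℝ, 0 < s ∧ phiDist φ K (p.1 + s • p.2) = s}

/-- The `φ`-reach `sup {s > 0 : phiDist φ K (a + s η) = s}`, with values in `(0, ∞]` on the unit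
`φ`-normal bundle; the supremum is taken in the extended reals. -/
noncomputable def phiReach {n : ℕ} (φ : Seminorm ℝ (EuclideanSpace ℝ (Fin n)))
    (K : Set (EuclideanSpace ℝ (Fin n))) (a η : EuclideanSpace ℝ (Fin n)) : EReal :=
  sSup ((fun s : ℝ => (s : EReal)) '' {s : ℝ | 0 < s ∧ phiDist φ K (a + s • η) = s})

/-- The set of points `a + ρ η` with `(a, η)` in the unit `φ`-normal bundle of `K`, `s ≤ ρ ≤ t`
and `σ ρ ≤ phiReach φ K a η`. -/
def awayFromCut {n : ℕ} (φ : Seminorm ℝ (EuclideanSpace ℝ (Fin n)))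
    (K : Set (EuclideanSpace ℝ (Fin n))) (σ s t : ℝ) : Set (EuclideanSpace ℝ (Fin n)) :=
  {x | ∃ (a η : EuclideanSpace ℝ (Fin n)) (ρ : ℝ), (a, η) ∈ unitNormalBundle φ K ∧
    s ≤ ρ ∧ ρ ≤ t ∧ ((σ * ρ : ℝ) : EReal) ≤ phiReach φ K a η ∧ x = a + ρ • η}

/-!
If the segment from `a ∈ K` in the direction `η` stays minimizing up to time `r`, then at each time
`ρ ∈ (0, r)` the distance function is squeezed between `y ↦ r - φ (a + r η - y)` and
`y ↦ φ (y - a)`, with equality at `y = a + ρ η`. Both of these functions have the derivative of `φ`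
at `η` as derivative there, and by homogeneity their second order remainders are of size
`C / (r - ρ)` and `C / ρ`. On `awayFromCut φ K σ s t` these are bounded uniformly, and a function
that has first order expansions with uniformly quadratic remainder at the points of a set has a
Lipschitz gradient there.
-/

open Metric Set

open scoped NNReal

section QuadraticApprox

variable {E F : Type*} [NormedAddCommGroup E] [NormedSpace ℝ E]
  [NormedAddCommGroup F] [NormedSpace ℝ F]

/-- `f` has at `x` the first order expansion `f x + D v` with remainder at most `C * ‖v‖ ^ 2`. The
bound is required for all increments `v`, not only for small ones, so that it can be compared at
two points however far apart they are. -/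
def HasQuadraticApprox (f : E → F) (D : E →L[ℝ] F) (x : E) (C : ℝ) : Prop :=
  ∀ v, ‖f (x + v) - f x - D v‖ ≤ C * ‖v‖ ^ 2

namespace HasQuadraticApprox

variable {f : E → F} {D : E →L[ℝ] F} {x : E} {C : ℝ}

theorem mono {C' : ℝ} (h : HasQuadraticApprox f D x C) (hC : C ≤ C') :
    HasQuadraticApprox f D x C' :=
  fun v => (h v).trans (by gcongr)

theorem comp_sub {a : E} (h : HasQuadraticApprox f D (x - a) C) :
    HasQuadraticApprox (fun y => f (y - a)) D x C := fun v => by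
  simpa only [add_sub_right_comm] using h v

theorem const_sub_comp_const_sub {b : E} (h : HasQuadraticApprox f D (b - x) C) (c : F) :
    HasQuadraticApprox (fun y => c - f (b - y)) D x C := fun v => by
  calc
    ‖c - f (b - (x + v)) - (c - f (b - x)) - D v‖
        = ‖-(f (b - x + -v) - f (b - x) - D (-v))‖ := by
      rw [← sub_sub, ← sub_eq_add_neg, map_neg]
      congr 1
      abel
    _ ≤ C * ‖v‖ ^ 2 := by simpa only [norm_neg] using h (-v)

theorem hasFDerivAt (h : HasQuadraticApprox f D x C) : HasFDerivAt f D x := by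
  have hO : (fun v => f (x + v) - f x - D v) =O[nhds 0] fun v => ‖v‖ ^ 2 :=
    .of_bound C (.of_forall fun v => by simpa only [norm_pow, norm_norm] using h v)
  exact hasFDerivAt_iff_isLittleO_nhds_zero.2
    (hO.trans_isLittleO (Asymptotics.isLittleO_norm_pow_id one_lt_two))

theorem norm_fderiv_sub_le {p q : E} {P Q : E →L[ℝ] F} (hp : HasQuadraticApprox f P p C)
    (hq : HasQuadraticApprox f Q q C) : ‖P - Q‖ ≤ 6 * C * ‖p - q‖ := by
  rcases eq_or_ne p q with rfl | hpq
  · simp [hp.hasFDerivAt.unique hq.hasFDerivAt]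
  set d := ‖p - q‖
  have d_pos : 0 < d := norm_pos_iff.2 (sub_ne_zero.2 hpq)
  have C_nonneg : 0 ≤ C :=
    nonneg_of_mul_nonneg_left ((norm_nonneg _).trans (hp (p - q))) (by positivity)
  refine ContinuousLinearMap.opNorm_le_of_unit_norm (by positivity) fun u hu => ?_
  -- Compare the expansions at `p` and at `q` of the value of `f` at `q + w`, where `‖w‖ = ‖p - q‖`.
  set w := d • u with hw
  have norm_w : ‖w‖ = d := by rw [hw, norm_smul, hu, mul_one, Real.norm_of_nonneg d_pos.le]
  have norm_w_add : ‖w + (q - p)‖ ≤ 2 * d := by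
    linarith [norm_add_le w (q - p), norm_sub_rev p q]
  have identity : (P - Q) w = (f (q + w) - f q - Q w)
      - (f (p + (w + (q - p))) - f p - P (w + (q - p)))
      + (f (p + (q - p)) - f p - P (q - p)) := by
    rw [show p + (w + (q - p)) = q + w by abel, add_sub_cancel, map_add, sub_apply]
    abel
  have scaled : d * ‖(P - Q) u‖ ≤ d * (6 * C * d) := calc
    d * ‖(P - Q) u‖ = ‖(P - Q) w‖ := by rw [hw, map_smul, norm_smul, Real.norm_of_nonneg d_pos.le]
    _ ≤ C * ‖w‖ ^ 2 + C * ‖w + (q - p)‖ ^ 2 + C * ‖q - p‖ ^ 2 := by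
      rw [identity]
      exact norm_add_le_of_le (norm_sub_le_of_le (hq w) (hp _)) (hp _)
    _ ≤ C * d ^ 2 + C * (2 * d) ^ 2 + C * d ^ 2 := by
      rw [norm_w, norm_sub_rev q p]
      gcongr
    _ = d * (6 * C * d) := by ring
  exact le_of_mul_le_mul_left scaled d_pos

theorem squeeze {f g k : E → ℝ} {D : E →L[ℝ] ℝ} (hg : HasQuadraticApprox g D x C)
    (hk : HasQuadraticApprox k D x C) (hgf : ∀ y, g y ≤ f y) (hfk : ∀ y, f y ≤ k y)
    (hgx : g x = f x) (hkx : k x = f x) : HasQuadraticApprox f D x C := fun v => by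
  have lower := (abs_le.1 (hg v)).1
  have upper := (abs_le.1 (hk v)).2
  rw [Real.norm_eq_abs, abs_le]
  constructor <;> linarith [hgf (x + v), hfk (x + v)]

theorem seminorm_smul {φ : Seminorm ℝ E} {D : E →L[ℝ] ℝ} (h : HasQuadraticApprox φ D x C)
    {c : ℝ} (hc : 0 < c) : HasQuadraticApprox φ D (c • x) (C / c) := fun v => by
  have hφ (y : E) : φ (c • y) = c * φ y := by
    rw [map_smul_eq_mul, Real.norm_of_nonneg hc.le]
  obtain ⟨w, rfl⟩ : ∃ w, c • w = v := ⟨c⁻¹ • v, smul_inv_smul₀ hc.ne' v⟩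
  calc
    ‖φ (c • x + c • w) - φ (c • x) - D (c • w)‖ = c * ‖φ (x + w) - φ x - D w‖ := by
      rw [← smul_add, hφ, hφ, map_smul, smul_eq_mul, ← mul_sub, ← mul_sub, norm_mul,
        Real.norm_of_nonneg hc.le]
    _ ≤ c * (C * ‖w‖ ^ 2) := by gcongr; exact h w
    _ = C / c * ‖c • w‖ ^ 2 := by
      rw [norm_smul, Real.norm_of_nonneg hc.le]
      field_simp

end HasQuadraticApprox

theorem lipschitzOnWith_gradient_of_hasQuadraticApprox {H : Type*} [NormedAddCommGroup H]
    [InnerProductSpace ℝ H] [CompleteSpace H] {f : H → ℝ} {S : Set H} {C : ℝ}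
    (h : ∀ x ∈ S, ∃ D, HasQuadraticApprox f D x C) :
    LipschitzOnWith (6 * C).toNNReal (gradient f) S := by
  refine LipschitzOnWith.of_dist_le' fun x hx y hy => ?_
  obtain ⟨P, hP⟩ := h x hx
  obtain ⟨Q, hQ⟩ := h y hy
  rw [dist_eq_norm, dist_eq_norm, gradient, gradient, hP.hasFDerivAt.fderiv,
    hQ.hasFDerivAt.fderiv, ← map_sub, LinearIsometryEquiv.norm_map]
  exact hP.norm_fderiv_sub_le hQ

theorem norm_add_sub_sub_fderiv_le_sq {f : E → F} {x : E} {r M : ℝ}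
    (hf : ∀ y ∈ closedBall x r, DifferentiableAt ℝ f y)
    (hf' : ∀ y ∈ closedBall x r, DifferentiableAt ℝ (fderiv ℝ f) y)
    (hM : ∀ y ∈ closedBall x r, ‖fderiv ℝ (fderiv ℝ f) y‖ ≤ M) {v : E} (hv : ‖v‖ ≤ r) :
    ‖f (x + v) - f x - fderiv ℝ f x v‖ ≤ M * ‖v‖ ^ 2 := by
  have hx : x ∈ closedBall x ‖v‖ := mem_closedBall_self (norm_nonneg v)
  have hsub : closedBall x ‖v‖ ⊆ closedBall x r := closedBall_subset_closedBall hv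
  have M_nonneg : 0 ≤ M := (norm_nonneg (fderiv ℝ (fderiv ℝ f) x)).trans (hM x (hsub hx))
  have fderiv_close : ∀ y ∈ closedBall x ‖v‖, ‖fderiv ℝ f y - fderiv ℝ f x‖ ≤ M * ‖v‖ := by
    intro y hy
    calc
      ‖fderiv ℝ f y - fderiv ℝ f x‖ ≤ M * ‖y - x‖ :=
        (_root_.convex_closedBall x ‖v‖).norm_image_sub_le_of_norm_fderiv_le
          (fun z hz => hf' z (hsub hz)) (fun z hz => hM z (hsub hz)) hx hy
      _ ≤ M * ‖v‖ := by gcongr; exact mem_closedBall_iff_norm.1 hy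
  have remainder := (_root_.convex_closedBall x ‖v‖).norm_image_sub_le_of_norm_fderiv_le'
    (fun y hy => hf y (hsub hy)) fderiv_close hx
    (show x + v ∈ closedBall x ‖v‖ by simp)
  rwa [add_sub_cancel_left, mul_assoc, ← sq] at remainder

theorem HasQuadraticApprox.of_lipschitzWith {f : E → F} {x : E} {B : ℝ≥0} {r M : ℝ}
    (hf : LipschitzWith B f) (hr : 0 < r) (hM : 0 ≤ M)
    (hloc : ∀ v, ‖v‖ ≤ r → ‖f (x + v) - f x - fderiv ℝ f x v‖ ≤ M * ‖v‖ ^ 2) :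
    HasQuadraticApprox f (fderiv ℝ f x) x (M + 2 * B / r) := fun v => by
  rcases le_or_gt ‖v‖ r with hv | hv
  · refine (hloc v hv).trans ?_
    gcongr
    exact le_add_of_nonneg_right (by positivity)
  calc
    ‖f (x + v) - f x - fderiv ℝ f x v‖ ≤ B * ‖v‖ + B * ‖v‖ := by
      refine norm_sub_le_of_le ?_
        ((fderiv ℝ f x).le_of_opNorm_le (norm_fderiv_le_of_lipschitz ℝ hf) v)
      simpa only [add_sub_cancel_left] using hf.norm_sub_le (x + v) x
    _ = 2 * B / r * (r * ‖v‖) := by field_simp; ring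
    _ ≤ 2 * B / r * (‖v‖ * ‖v‖) := by gcongr
    _ ≤ (M + 2 * B / r) * ‖v‖ ^ 2 := by
      rw [← sq]
      gcongr
      exact le_add_of_nonneg_left hM

theorem exists_hasQuadraticApprox_of_isCompact [ProperSpace E] {f : E → F} {U S : Set E} {B : ℝ≥0}
    (hf : LipschitzWith B f) (hU : IsOpen U) (hfU : ContDiffOn ℝ 2 f U) (hS : IsCompact S)
    (hSU : S ⊆ U) : ∃ C, 0 ≤ C ∧ ∀ x ∈ S, HasQuadraticApprox f (fderiv ℝ f x) x C := by
  have hfU' : ContDiffOn ℝ 1 (fderiv ℝ f) U := hfU.fderiv_of_isOpen hU (by norm_num)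
  obtain ⟨r, hr, hrU⟩ := hS.exists_cthickening_subset_open hU hSU
  obtain ⟨M, hM⟩ := hS.cthickening.exists_bound_of_continuousOn
    ((hfU'.continuousOn_fderiv_of_isOpen hU (by norm_num)).mono hrU)
  refine ⟨max M 0 + 2 * B / r, by positivity, fun x hx => ?_⟩
  have hball : closedBall x r ⊆ cthickening r S := closedBall_subset_cthickening hx r
  refine HasQuadraticApprox.of_lipschitzWith hf hr (le_max_right M 0) fun v hv =>
    norm_add_sub_sub_fderiv_le_sq (fun y hy => ?_) (fun y hy => ?_)
      (fun y hy => (hM y (hball hy)).trans (le_max_left M 0)) hv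
  · exact (hfU.differentiableOn (by norm_num)).differentiableAt (hU.mem_nhds (hrU (hball hy)))
  · exact (hfU'.differentiableOn (by norm_num)).differentiableAt (hU.mem_nhds (hrU (hball hy)))

theorem lipschitzWith_seminorm_of_le_mul_norm {φ : Seminorm ℝ E} {B : ℝ}
    (h : ∀ x, φ x ≤ B * ‖x‖) : LipschitzWith B.toNNReal φ :=
  LipschitzWith.of_dist_le' fun x y => by
    rw [dist_eq_norm, dist_eq_norm]
    exact (abs_sub_map_le_sub φ x y).trans (h _)

theorem exists_hasQuadraticApprox_seminorm [FiniteDimensional ℝ E] {φ : Seminorm ℝ E}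
    (hφ : ContDiffOn ℝ 2 φ {0}ᶜ) :
    ∃ C, 0 ≤ C ∧ ∀ η, φ η = 1 → HasQuadraticApprox φ (fderiv ℝ φ η) η C := by
  obtain ⟨B, B_pos, hB⟩ := Seminorm.bound_of_continuous_normedSpace φ
    (continuousOn_univ.1 (φ.convexOn.continuousOn isOpen_univ))
  obtain ⟨C, hC, approx⟩ := exists_hasQuadraticApprox_of_isCompact
    (lipschitzWith_seminorm_of_le_mul_norm hB) isOpen_compl_singleton hφ
    (isCompact_sphere (0 : E) 1) (fun x hx => ne_of_mem_sphere hx one_ne_zero)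
  refine ⟨C * B, by positivity, fun η hη => ?_⟩
  have η_norm_pos : 0 < ‖η‖ := norm_pos_iff.2 fun h => by simp [h] at hη
  have scaled : HasQuadraticApprox φ (fderiv ℝ φ (‖η‖⁻¹ • η)) η (C / ‖η‖) := by
    have h := (approx (‖η‖⁻¹ • η) (by simp [norm_smul, η_norm_pos.ne'])).seminorm_smul η_norm_pos
    rwa [smul_inv_smul₀ η_norm_pos.ne'] at h
  rw [scaled.hasFDerivAt.fderiv]
  refine scaled.mono ?_
  rw [div_le_iff₀ η_norm_pos, mul_assoc]
  exact le_mul_of_one_le_right hC (hη ▸ hB η)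

end QuadraticApprox

section PhiDist

variable {n : ℕ} {φ : Seminorm ℝ (EuclideanSpace ℝ (Fin n))} {K : Set (EuclideanSpace ℝ (Fin n))}
  {a η : EuclideanSpace ℝ (Fin n)} {ρ r : ℝ}

theorem phiDist_le (ha : a ∈ K) (x : EuclideanSpace ℝ (Fin n)) : phiDist φ K x ≤ φ (x - a) := by
  rw [map_sub_rev]
  exact csInf_le ⟨0, by rintro _ ⟨y, -, rfl⟩; exact apply_nonneg φ _⟩ ⟨a, ha, rfl⟩

theorem phiDist_le_add (hK : K.Nonempty) (x y : EuclideanSpace ℝ (Fin n)) :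
    phiDist φ K y ≤ phiDist φ K x + φ (y - x) := by
  rw [← sub_le_iff_le_add]
  refine le_csInf (hK.image _) ?_
  rintro _ ⟨k, hk, rfl⟩
  rw [sub_le_iff_le_add]
  calc
    phiDist φ K y ≤ φ (y - x + (x - k)) := by
      rw [sub_add_sub_cancel]
      exact phiDist_le hk y
    _ ≤ φ (y - x) + φ (x - k) := map_add_le_add φ _ _
    _ = φ (k - x) + φ (y - x) := by rw [map_sub_rev φ x k, add_comm]

theorem apply_smul_of_apply_eq_one (hη : φ η = 1) (hρ : 0 ≤ ρ) : φ (ρ • η) = ρ := by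
  rw [map_smul_eq_mul, hη, mul_one, Real.norm_of_nonneg hρ]

theorem phiDist_add_smul_eq_of_le (ha : a ∈ K) (hη : φ η = 1) (hρ : 0 ≤ ρ) (hρr : ρ ≤ r)
    (hr : phiDist φ K (a + r • η) = r) : phiDist φ K (a + ρ • η) = ρ := by
  have upper := phiDist_le (φ := φ) ha (a + ρ • η)
  have lower := phiDist_le_add (φ := φ) ⟨a, ha⟩ (a + ρ • η) (a + r • η)
  rw [add_sub_cancel_left, apply_smul_of_apply_eq_one hη hρ] at upper
  rw [hr, add_sub_add_left_eq_sub, ← sub_smul,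
    apply_smul_of_apply_eq_one hη (sub_nonneg.2 hρr)] at lower
  linarith

theorem phiDist_add_smul_eq_of_lt_phiReach (ha : a ∈ K) (hη : φ η = 1) (hρ : 0 ≤ ρ)
    (h : (ρ : EReal) < phiReach φ K a η) : phiDist φ K (a + ρ • η) = ρ := by
  obtain ⟨_, ⟨r, ⟨-, hr⟩, rfl⟩, hρr⟩ := lt_sSup_iff.1 h
  exact phiDist_add_smul_eq_of_le ha hη hρ (EReal.coe_lt_coe_iff.1 hρr).le hr

theorem hasQuadraticApprox_phiDist {D : EuclideanSpace ℝ (Fin n) →L[ℝ] ℝ} {C δ : ℝ} (hC : 0 ≤ C)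
    (hD : HasQuadraticApprox φ D η C) (ha : a ∈ K) (hη : φ η = 1) (hδ : 0 < δ) (hδρ : δ ≤ ρ)
    (hδr : δ ≤ r - ρ) (hr : phiDist φ K (a + r • η) = r) :
    HasQuadraticApprox (phiDist φ K) D (a + ρ • η) (C / δ) := by
  have hρ : 0 < ρ := hδ.trans_le hδρ
  have hρr : 0 < r - ρ := hδ.trans_le hδr
  have approx {c : ℝ} (hc : δ ≤ c) : HasQuadraticApprox φ D (c • η) (C / δ) :=
    (hD.seminorm_smul (hδ.trans_le hc)).mono (by gcongr)
  have from_a : a + ρ • η - a = ρ • η := add_sub_cancel_left _ _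
  have to_end : a + r • η - (a + ρ • η) = (r - ρ) • η := by module
  have dist_eq := phiDist_add_smul_eq_of_le ha hη hρ.le (sub_nonneg.1 hρr.le) hr
  refine HasQuadraticApprox.squeeze (g := fun y => r - φ (a + r • η - y))
    (k := fun y => φ (y - a)) (.const_sub_comp_const_sub ?_ r) (.comp_sub ?_)
    (fun y => ?_) (phiDist_le ha) ?_ ?_
  · rw [to_end]
    exact approx hδr
  · rw [from_a]
    exact approx hδρ
  · rw [sub_le_iff_le_add]
    exact hr.symm.trans_le (phiDist_le_add ⟨a, ha⟩ y (a + r • η))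
  · rw [to_end, apply_smul_of_apply_eq_one hη hρr.le, dist_eq, sub_sub_cancel]
  · rw [from_a, apply_smul_of_apply_eq_one hη hρ.le, dist_eq]

theorem exists_hasQuadraticApprox_phiDist_on_awayFromCut (hφ : ContDiffOn ℝ 2 φ {0}ᶜ)
    (K : Set (EuclideanSpace ℝ (Fin n))) {σ s : ℝ} (hσ : 1 < σ) (hs : 0 < s) :
    ∃ M, ∀ x ∈ ⋃ t, awayFromCut φ K σ s t, ∃ D, HasQuadraticApprox (phiDist φ K) D x M := by
  obtain ⟨C, hC, approx⟩ := exists_hasQuadraticApprox_seminorm hφ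
  obtain ⟨σ', hσ', hσ'σ⟩ := exists_between hσ
  refine ⟨C / (min 1 (σ' - 1) * s), fun x hx => ?_⟩
  obtain ⟨t, a, η, ρ, ⟨ha, hη, -⟩, hsρ, -, hreach, rfl⟩ := mem_iUnion.1 hx
  have hρ : 0 < ρ := hs.trans_le hsρ
  have gap_pos : 0 < min 1 (σ' - 1) := lt_min one_pos (sub_pos.2 hσ')
  have minimizing : phiDist φ K (a + (σ' * ρ) • η) = σ' * ρ :=
    phiDist_add_smul_eq_of_lt_phiReach ha hη (by positivity)
      (lt_of_lt_of_le (EReal.coe_lt_coe_iff.2 (by gcongr)) hreach)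
  refine ⟨fderiv ℝ φ η,
    hasQuadraticApprox_phiDist hC (approx η hη) ha hη (mul_pos gap_pos hs) ?_ ?_ minimizing⟩
  · calc
      min 1 (σ' - 1) * s ≤ 1 * ρ := by gcongr; exact min_le_left _ _
      _ = ρ := one_mul ρ
  · calc
      min 1 (σ' - 1) * s ≤ (σ' - 1) * ρ := by gcongr; exact min_le_right _ _
      _ = σ' * ρ - ρ := by ring

end PhiDist

theorem theorem1p4_general {n : ℕ} {φ : Seminorm ℝ (EuclideanSpace ℝ (Fin n))}
    (hφ : ContDiffOn ℝ 2 φ {0}ᶜ) (K : Set (EuclideanSpace ℝ (Fin n))) {σ s : ℝ} (hσ : 1 < σ)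
    (hs : 0 < s) :
    (∀ x ∈ ⋃ t, awayFromCut φ K σ s t, DifferentiableAt ℝ (phiDist φ K) x) ∧
      ∃ L : ℝ≥0, LipschitzOnWith L (gradient (phiDist φ K)) (⋃ t, awayFromCut φ K σ s t) := by
  obtain ⟨M, approx⟩ := exists_hasQuadraticApprox_phiDist_on_awayFromCut hφ K hσ hs
  refine ⟨fun x hx => ?_, _, lipschitzOnWith_gradient_of_hasQuadraticApprox approx⟩
  obtain ⟨D, hD⟩ := approx x hx
  exact hD.hasFDerivAt.differentiableAt

theorem theorem1p4 (n : ℕ) (φ : Seminorm ℝ (EuclideanSpace ℝ (Fin n)))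
    (hφ : IsUniformlyConvexNorm φ) (hφ2 : ContDiffOn ℝ 2 φ {0}ᶜ)
    (K : Set (EuclideanSpace ℝ (Fin n))) (hK : IsClosed K)
    (σ s t : ℝ) (hσ : 1 < σ) (hs : 0 < s) (hst : s < t) :
    (∀ x ∈ awayFromCut φ K σ s t, DifferentiableAt ℝ (phiDist φ K) x) ∧
      ∃ L : NNReal, LipschitzOnWith L (gradient (phiDist φ K)) (awayFromCut φ K σ s t) := by
  obtain ⟨differentiable, L, lipschitz⟩ := theorem1p4_general hφ2 K hσ hs
  have subset : awayFromCut φ K σ s t ⊆ ⋃ t, awayFromCut φ K σ s t := subset_iUnion _ t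
  exact ⟨fun x hx => differentiable x (subset hx), L, lipschitz.mono subset⟩
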